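/- All graphs are finite, simple and undirected, with at least one vertex. For a graph $G$ on $n$ vertices let $0=\mu_1(G)\le\mu_2(G)\le\cdots\le\mu_n(G)$ be the eigenvalues of its Laplacian matrix $L(G)=D(G)-A(G)$, listed with multiplicity. The resistance distance between two vertices of a connected graph $G$ is the potential difference between them when a unit current enters at one and leaves at the other, every edge being a unit resistor; the Kirchhoff index $Kf(G)$ is the sum of the resistance distances over all unordered pairs of vertices of $G$. For vertex-disjoint graphs $G_1$ and $G_2$, the subdivision-vertex join $G_1\dot\vee G_2$ is the graph obtained from the subdivision graph $\mathcal S(G_1)$ (a new vertex is inserted into every edge of $G_1$) and $G_2$ by joining every (old) vertex of $V(G_1)$ with every vertex of $V(G_2)$. Let $G_1$ be an $r_1$-regular graph on $n_1\ge1$ vertices and $m_1$ edges, and let $G_2$ be an arbitrary graph on $n_2\ge1$ vertices. Then $$Kf(G_1\dot\vee G_2)=(m_1+n_1+n_2)\left(\frac{m_1-n_1}{2}+\frac{2+r_1+n_1+n_2}{2n_1+2n_2+n_1r_1}+\sum_{i=2}^{n_2}\frac{1}{n_1+\mu_i(G_2)}+\sum_{i=2}^{n_1}\frac{2+r_1+n_2}{2n_2+\mu_i(G_1)}\right).$$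 -/

import Mathlib

namespace SubdivisionJoin

/-- The subdivision graph of `G`: a new vertex is inserted into every edge of `G`. Its vertices are
the old ones (`Sum.inl v`) and one new vertex for each edge (`Sum.inr e`), and the new vertex
of `e` is joined to the two ends of `e`. -/
def subdivision {V : Type*} (G : SimpleGraph V) : SimpleGraph (V ⊕ G.edgeSet) where
  Adj x y := match x, y with
    | Sum.inl v, Sum.inr e => v ∈ (e : Sym2 V)
    | Sum.inr e, Sum.inl v => v ∈ (e : Sym2 V)
    | _, _ => False
  symm := ⟨by rintro (a | a) (b | b) h <;> exact h⟩
  loopless := ⟨by rintro (a | a) h <;> exact h⟩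

/-- The subdivision-vertex join of `G₁` and `G₂`: the disjoint union of the subdivision graph
of `G₁` and `G₂`, in which every old vertex of `G₁` is joined to every vertex of `G₂`. -/
def subdivisionVertexJoin {V₁ V₂ : Type*} (G₁ : SimpleGraph V₁) (G₂ : SimpleGraph V₂) :
    SimpleGraph ((V₁ ⊕ G₁.edgeSet) ⊕ V₂) where
  Adj x y := match x, y with
    | Sum.inl a, Sum.inl b => (subdivision G₁).Adj a b
    | Sum.inr a, Sum.inr b => G₂.Adj a b
    | Sum.inl (Sum.inl _), Sum.inr _ => True
    | Sum.inr _, Sum.inl (Sum.inl _) => True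
    | _, _ => False
  symm := ⟨by
    rintro ((a | a) | a) ((b | b) | b) h <;> first | exact h | exact SimpleGraph.Adj.symm h⟩
  loopless := ⟨by
    rintro ((a | a) | a) h <;> first | exact h | exact G₂.loopless.irrefl _ h⟩

instance {V : Type*} [DecidableEq V] (G : SimpleGraph V) : DecidableRel (subdivision G).Adj
  | Sum.inl _, Sum.inl _ => inferInstanceAs (Decidable False)
  | Sum.inl v, Sum.inr e => inferInstanceAs (Decidable (v ∈ (e : Sym2 V)))
  | Sum.inr e, Sum.inl v => inferInstanceAs (Decidable (v ∈ (e : Sym2 V)))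
  | Sum.inr _, Sum.inr _ => inferInstanceAs (Decidable False)

instance {V₁ V₂ : Type*} [DecidableEq V₁] (G₁ : SimpleGraph V₁) (G₂ : SimpleGraph V₂)
    [DecidableRel G₂.Adj] : DecidableRel (subdivisionVertexJoin G₁ G₂).Adj
  | Sum.inl a, Sum.inl b => inferInstanceAs (Decidable ((subdivision G₁).Adj a b))
  | Sum.inr a, Sum.inr b => inferInstanceAs (Decidable (G₂.Adj a b))
  | Sum.inl (Sum.inl _), Sum.inr _ => inferInstanceAs (Decidable True)
  | Sum.inr _, Sum.inl (Sum.inl _) => inferInstanceAs (Decidable True)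
  | Sum.inl (Sum.inr _), Sum.inr _ => inferInstanceAs (Decidable False)
  | Sum.inr _, Sum.inl (Sum.inr _) => inferInstanceAs (Decidable False)

section
variable {V : Type*} [Fintype V] [DecidableEq V]

/-- The Laplacian eigenvalues `μ₁ ≤ μ₂ ≤ ⋯ ≤ μₙ` of a graph on `n` vertices (listed with
multiplicity, numbered from `1`; indices outside `1, …, n` get the value `0`).
Mathlib lists the eigenvalues of a Hermitian matrix in decreasing order, numbered from `0`. -/
noncomputable def lapEigenvalue (G : SimpleGraph V) [DecidableRel G.Adj] (i : ℕ) : ℝ :=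
  if h : 1 ≤ i ∧ i ≤ Fintype.card V then
    (G.isHermitian_lapMatrix ℝ).eigenvalues₀ ⟨Fintype.card V - i, by omega⟩
  else 0

/-- `f` is an electric potential for a unit current which enters at `u` and leaves at `v`, when
every edge of `G` is a unit resistor: by Ohm's law the current from `x` to a neighbour `y` is
`f x - f y`, and by Kirchhoff's current law the net current out of `x` into the network is
`1` at `u`, `-1` at `v` and `0` elsewhere (and `0` everywhere if `u = v`). -/
def IsUnitCurrentPotential (G : SimpleGraph V) [DecidableRel G.Adj] (u v : V) (f : V → ℝ) : Prop :=
  ∀ x, ∑ y ∈ G.neighborFinset x, (f x - f y) =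
    (if x = u then 1 else 0) - (if x = v then 1 else 0)

open Classical in
/-- The resistance distance between `u` and `v`: the potential difference between `u` and `v`
for a unit current from `u` to `v`. In a connected graph such a potential exists and the
difference does not depend on its choice (see the two lemmas below); the value `0` is used if
there is no such potential, that is, if `u` and `v` lie in different components. -/
noncomputable def resistanceDist (G : SimpleGraph V) [DecidableRel G.Adj] (u v : V) : ℝ :=
  if h : ∃ f, IsUnitCurrentPotential G u v f then h.choose u - h.choose v else 0

/-- The Kirchhoff index: the sum of the resistance distances over all unordered pairs of
vertices, that is, half of the sum over all ordered pairs. -/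
noncomputable def kirchhoffIndex (G : SimpleGraph V) [DecidableRel G.Adj] : ℝ :=
  (∑ u, ∑ v, resistanceDist G u v) / 2

theorem isUnitCurrentPotential_iff (G : SimpleGraph V) [DecidableRel G.Adj] (u v : V) (f : V → ℝ) :
    IsUnitCurrentPotential G u v f ↔
      (G.lapMatrix ℝ).mulVec f = Pi.single u 1 - Pi.single v 1 := by
  unfold IsUnitCurrentPotential
  rw [funext_iff]
  refine forall_congr' fun x => ?_
  rw [SimpleGraph.lapMatrix_mulVec_apply, Finset.sum_sub_distrib]
  simp [Pi.single_apply]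

theorem resistanceDist_eq {G : SimpleGraph V} [DecidableRel G.Adj] {u v : V} {f : V → ℝ}
    (hf : IsUnitCurrentPotential G u v f) : resistanceDist G u v = f u - f v := by
  have h : ∃ f, IsUnitCurrentPotential G u v f := ⟨f, hf⟩
  rw [resistanceDist, dif_pos h]
  have hg := (isUnitCurrentPotential_iff G u v _).1 h.choose_spec
  have hf := (isUnitCurrentPotential_iff G u v _).1 hf
  set g := h.choose
  have key : f ⬝ᵥ (G.lapMatrix ℝ).mulVec g = g ⬝ᵥ (G.lapMatrix ℝ).mulVec f := by
    rw [Matrix.dotProduct_mulVec, ← Matrix.mulVec_transpose, (G.isSymm_lapMatrix (R := ℝ)).eq,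
      dotProduct_comm]
  rw [hf, hg] at key
  simpa [dotProduct_sub] using key.symm

theorem exists_isUnitCurrentPotential {G : SimpleGraph V} [DecidableRel G.Adj] (hG : G.Connected)
    (u v : V) : ∃ f, IsUnitCurrentPotential G u v f := by
  have : Nonempty V := ⟨u⟩
  have hn : (Fintype.card V : ℝ) ≠ 0 := by exact_mod_cast Fintype.card_ne_zero
  have hsum : ∀ f : V → ℝ, ∑ x, (G.lapMatrix ℝ).mulVec f x = 0 := fun f => by
    have h : (fun _ => (1 : ℝ)) ⬝ᵥ (G.lapMatrix ℝ).mulVec f = 0 := by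
      rw [Matrix.dotProduct_mulVec, ← Matrix.mulVec_transpose, (G.isSymm_lapMatrix (R := ℝ)).eq,
        SimpleGraph.lapMatrix_mulVec_const_eq_zero, zero_dotProduct]
    simpa [dotProduct] using h
  let T : (V → ℝ) →ₗ[ℝ] (V → ℝ) :=
    { toFun := fun f x => (G.lapMatrix ℝ).mulVec f x + ∑ y, f y
      map_add' := fun f g => by
        funext x
        simp only [Matrix.mulVec_add, Pi.add_apply, Finset.sum_add_distrib]
        ring
      map_smul' := fun c f => by
        funext x
        simp only [Matrix.mulVec_smul, Pi.smul_apply, smul_eq_mul, ← Finset.mul_sum,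
          RingHom.id_apply]
        ring }
  have hT : ∀ f x, T f x = (G.lapMatrix ℝ).mulVec f x + ∑ y, f y := fun _ _ => rfl
  have hTs : ∀ f, ∑ x, T f x = Fintype.card V * ∑ y, f y := fun f => by
    simp [hT, Finset.sum_add_distrib, hsum]
  have hinj : Function.Injective T := by
    rw [injective_iff_map_eq_zero]
    intro f hf
    have h0 : ∑ y, f y = 0 := by
      have := hTs f
      rw [hf] at this
      simpa [hn] using this.symm
    have hL : (G.lapMatrix ℝ).mulVec f = 0 := by
      funext x
      have := congrFun hf x
      rwa [hT, h0, add_zero] at this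
    rw [SimpleGraph.lapMatrix_mulVec_eq_zero_iff_forall_reachable] at hL
    funext x
    have hc : ∑ y, f y = ∑ _y : V, f x :=
      Finset.sum_congr rfl fun y _ => hL y x (hG.preconnected y x)
    rw [h0] at hc
    simpa [hn] using hc.symm
  obtain ⟨f, hf⟩ := LinearMap.injective_iff_surjective.1 hinj (Pi.single u 1 - Pi.single v 1)
  refine ⟨f, (isUnitCurrentPotential_iff G u v f).2 ?_⟩
  have h0 : ∑ y, f y = 0 := by
    have := hTs f
    rw [hf] at this
    simpa [hn] using this.symm
  rw [← hf]
  funext x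
  rw [hT, h0, add_zero]

end

end SubdivisionJoin

/-!
# Kirchhoff index of the subdivision-vertex join

Let `L` be the Laplacian of a graph on `N` vertices. If `L X = 1 - c 1ᵀ` for some matrix `X` and
column `c`, then column `u` minus column `v` of `X` is a potential for the unit current from `u`
to `v`, so the resistance distance is `X u u + X v v - X u v - X v u`, and the Kirchhoff index is
`N tr X - 1ᵀ X 1` (`kirchhoffIndex_eq_of_lapMatrix_mul`). No symmetry of `X` and no spectrum of the
join itself is needed.

For the subdivision-vertex join such an `X` (`joinInverse`) is found by solving `L x = b`. Let `B` be
the incidence matrix of `G₁`. Eliminating the edge vertices and using `B Bᵀ = 2 r₁ - L(G₁)` leaves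
the matrix `½ (L(G₁) + 2 n₂)` on `V₁`, and `L(G₂) + n₁` on `V₂`. The two parts are coupled only
through the sums of the potential over `V₁` and over `V₂`. Replacing the inverse on `V₁` by
`M = 2 (L(G₁) + 2 n₂)⁻¹ - J / (n₁ n₂)`, whose column sums vanish, makes `X` block diagonal with
respect to `V₁ ∪ E(G₁)` and `V₂`; the remaining defect is `c = 1 / n₁` on `V₁` and `0` elsewhere
(`lapMatrix_mul_joinInverse`).

The trace and the entry sum of `X` (`trace_joinInverse`, `sum_joinInverse`) involve only `n₁`, `n₂`,
`m₁`, `r₁` and the traces of `(L(G₁) + 2 n₂)⁻¹` and `(L(G₂) + n₁)⁻¹`. By the spectral theorem these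
traces are the eigenvalue sums of the formula (`exists_inverse_lapMatrix_add_smul_one`), the terms
for `μ₁ = 0` being split off; `n₁ r₁ = 2 m₁` then gives the closed form.
-/

namespace SubdivisionJoin

open Matrix

/-! ### Kirchhoff index and Laplacian spectrum -/

section General
variable {V : Type*} [Fintype V] [DecidableEq V]

/-- The Kirchhoff index from any right inverse of the Laplacian modulo a matrix with equal columns.
For such an `X`, the difference of its columns `u` and `v` is a potential for the unit current from
`u` to `v`. -/
theorem kirchhoffIndex_eq_of_lapMatrix_mul (G : SimpleGraph V) [DecidableRel G.Adj]
    (X : Matrix V V ℝ) (c : V → ℝ)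
    (h : G.lapMatrix ℝ * X = 1 - Matrix.of fun u _ => c u) :
    kirchhoffIndex G = Fintype.card V * X.trace - ∑ u, ∑ v, X u v := by
  have hcol : ∀ v, (G.lapMatrix ℝ).mulVec (X.col v) = Pi.single v 1 - c := fun v => by
    funext x
    have := congrFun (congrFun h x) v
    simpa [Matrix.mul_apply, Matrix.mulVec, dotProduct, Matrix.one_apply, Pi.single_apply]
      using this
  have hr : ∀ u v, resistanceDist G u v = X u u + X v v - X u v - X v u := fun u v => by
    have hf : IsUnitCurrentPotential G u v (X.col u - X.col v) := by
      rw [isUnitCurrentPotential_iff, Matrix.mulVec_sub, hcol, hcol]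
      abel
    rw [resistanceDist_eq hf]
    simp only [Pi.sub_apply, Matrix.col_apply]
    ring
  unfold kirchhoffIndex
  simp only [hr, Finset.sum_sub_distrib, Finset.sum_add_distrib, Finset.sum_const,
    Finset.card_univ, nsmul_eq_mul]
  rw [Finset.sum_comm (f := fun u v => X v u), ← Finset.mul_sum, Matrix.trace]
  simp only [Matrix.diag_apply]
  ring

theorem lapMatrix_apply (G : SimpleGraph V) [DecidableRel G.Adj] (x y : V) :
    G.lapMatrix ℝ x y =
      (if x = y then ∑ z, if G.Adj x z then 1 else 0 else 0) - if G.Adj x y then 1 else 0 := by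
  simp only [SimpleGraph.lapMatrix, SimpleGraph.degMatrix, Matrix.sub_apply,
    Matrix.diagonal_apply, SimpleGraph.adjMatrix_apply, SimpleGraph.degree_eq_sum_if_adj]

theorem lapMatrix_apply_self (G : SimpleGraph V) [DecidableRel G.Adj] (x : V) :
    G.lapMatrix ℝ x x = G.degree x := by
  simp [SimpleGraph.lapMatrix, SimpleGraph.degMatrix]

theorem sum_lapMatrix_apply (G : SimpleGraph V) [DecidableRel G.Adj] (y : V) :
    ∑ x, G.lapMatrix ℝ x y = 0 := by
  have h := congrFun (G.lapMatrix_mulVec_const_eq_zero (R := ℝ)) y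
  rw [← (G.isSymm_lapMatrix (R := ℝ)).eq] at h
  simpa [Matrix.mulVec, dotProduct] using h

/-- The smallest Laplacian eigenvalue is `0`: the Laplacian is positive semidefinite and
singular. -/
theorem lapEigenvalue_one [Nonempty V] (G : SimpleGraph V) [DecidableRel G.Adj] :
    lapEigenvalue G 1 = 0 := by
  have hA := G.isHermitian_lapMatrix ℝ
  have hpos : 0 < Fintype.card V := Fintype.card_pos
  rw [lapEigenvalue, dif_pos ⟨le_rfl, hpos⟩]
  apply le_antisymm
  · have hdet := G.det_lapMatrix_eq_zero
    rw [hA.det_eq_prod_eigenvalues] at hdet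
    obtain ⟨j, -, hj⟩ := Finset.prod_eq_zero_iff.1 hdet
    replace hj : hA.eigenvalues j = 0 := by simpa using hj
    rw [← hj]
    apply hA.eigenvalues₀_antitone
    rw [Fin.le_def]
    have := ((Fintype.equivOfCardEq (Fintype.card_fin (Fintype.card V))).symm j).isLt
    simp only
    omega
  · have := (G.posSemidef_lapMatrix ℝ).eigenvalues_nonneg
      (Fintype.equivOfCardEq (Fintype.card_fin (Fintype.card V))
        ⟨Fintype.card V - 1, by omega⟩)
    simpa [Matrix.IsHermitian.eigenvalues] using this

theorem sum_eigenvalues_eq_sum_lapEigenvalue [Nonempty V] (G : SimpleGraph V) [DecidableRel G.Adj]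
    (f : ℝ → ℝ) :
    ∑ j, f ((G.isHermitian_lapMatrix ℝ).eigenvalues j) =
      f 0 + ∑ i ∈ Finset.Icc 2 (Fintype.card V), f (lapEigenvalue G i) := by
  have hpos : 1 ≤ Fintype.card V := Fintype.card_pos
  have h1 : f 0 + ∑ i ∈ Finset.Icc 2 (Fintype.card V), f (lapEigenvalue G i) =
      ∑ i ∈ Finset.Icc 1 (Fintype.card V), f (lapEigenvalue G i) := by
    rw [← lapEigenvalue_one G]
    exact Finset.add_sum_Ioc_eq_sum_Icc (f := fun i => f (lapEigenvalue G i)) hpos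
  rw [h1]
  have h2 : ∑ j, f ((G.isHermitian_lapMatrix ℝ).eigenvalues j) =
      ∑ j, f ((G.isHermitian_lapMatrix ℝ).eigenvalues₀ j) :=
    Equiv.sum_comp (Fintype.equivOfCardEq (Fintype.card_fin (Fintype.card V))).symm
      fun j => f ((G.isHermitian_lapMatrix ℝ).eigenvalues₀ j)
  rw [h2]
  -- `lapEigenvalue` counts upwards from `1`, `eigenvalues₀` downwards from the top.
  refine Finset.sum_bij' (fun j _ => Fintype.card V - j)
    (fun i hi => ⟨Fintype.card V - i, by have := Finset.mem_Icc.1 hi; omega⟩) ?_ ?_ ?_ ?_ ?_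
  · intro j _
    have := j.isLt
    exact Finset.mem_Icc.2 ⟨by omega, by omega⟩
  · intro i hi
    exact Finset.mem_univ _
  · intro j _
    have := j.isLt
    ext
    simp only
    omega
  · intro i hi
    have := Finset.mem_Icc.1 hi
    simp only
    omega
  · intro j _
    have := j.isLt
    rw [lapEigenvalue, dif_pos ⟨by omega, by omega⟩]
    congr 2
    ext
    simp only
    omega

/-- By the spectral theorem, the trace of `(L + c)⁻¹` is a sum over the Laplacian eigenvalues; the
term `1 / c` comes from `μ₁ = 0`. -/
theorem exists_inverse_lapMatrix_add_smul_one [Nonempty V] (G : SimpleGraph V) [DecidableRel G.Adj]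
    {c : ℝ} (hc : 0 < c) :
    ∃ P : Matrix V V ℝ, (G.lapMatrix ℝ + c • 1) * P = 1 ∧
      P.trace = 1 / c + ∑ i ∈ Finset.Icc 2 (Fintype.card V), 1 / (c + lapEigenvalue G i) := by
  have hA := G.isHermitian_lapMatrix ℝ
  have hne : ∀ j, c + hA.eigenvalues j ≠ 0 := fun j =>
    (add_pos_of_pos_of_nonneg hc ((G.posSemidef_lapMatrix ℝ).eigenvalues_nonneg j)).ne'
  let U : Matrix V V ℝ := hA.eigenvectorUnitary
  have hU : star U * U = 1 := Unitary.coe_star_mul_self _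
  have hU' : U * star U = 1 := Unitary.coe_mul_star_self _
  have hspec : G.lapMatrix ℝ = U * diagonal hA.eigenvalues * star U := by
    conv_lhs => rw [hA.spectral_theorem, Unitary.conjStarAlgAut_apply]
    rfl
  have hL : G.lapMatrix ℝ + c • 1 = U * diagonal (fun j => c + hA.eigenvalues j) * star U := by
    have : diagonal (fun j => c + hA.eigenvalues j) =
        diagonal hA.eigenvalues + c • (1 : Matrix V V ℝ) := by
      rw [smul_one_eq_diagonal, diagonal_add]
      simp only [add_comm]
    rw [this, Matrix.mul_add, Matrix.add_mul, ← hspec]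
    simp [hU']
  refine ⟨U * diagonal (fun j => 1 / (c + hA.eigenvalues j)) * star U, ?_, ?_⟩
  · calc _ = U * (diagonal (fun j => c + hA.eigenvalues j) * (star U * U) *
        diagonal (fun j => 1 / (c + hA.eigenvalues j))) * star U := by
          rw [hL]; simp only [Matrix.mul_assoc]
      _ = 1 := by
          rw [hU, Matrix.mul_one, diagonal_mul_diagonal]
          simp [hne, hU']
  · rw [Matrix.trace_mul_comm, ← Matrix.mul_assoc, hU, Matrix.one_mul, trace_diagonal,
      sum_eigenvalues_eq_sum_lapEigenvalue G fun t => 1 / (c + t), add_zero]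

theorem sum_row_of_lapMatrix_add_smul_one_mul_eq_one {G : SimpleGraph V} [DecidableRel G.Adj]
    {c : ℝ} {P : Matrix V V ℝ} (h : (G.lapMatrix ℝ + c • 1) * P = 1) (j : V) :
    c * ∑ i, P i j = 1 := by
  have hs : ∑ i, ((G.lapMatrix ℝ + c • 1) * P) i j = 1 := by
    rw [h]
    simp [Matrix.one_apply]
  rw [Matrix.add_mul] at hs
  simp only [Matrix.add_apply, Finset.sum_add_distrib, Matrix.mul_apply] at hs
  rw [Finset.sum_comm] at hs
  simpa [← Finset.sum_mul, sum_lapMatrix_apply, Matrix.one_apply, Finset.mul_sum] using hs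

end General

/-! ### Incidence matrix of a regular graph -/

section Incidence
variable {V : Type*} [DecidableEq V]

/-- The vertex-edge incidence matrix with columns indexed by the edges only (the columns of
`SimpleGraph.incMatrix` are indexed by all of `Sym2 V`). -/
def edgeIncMatrix (G : SimpleGraph V) : Matrix V G.edgeSet ℝ :=
  Matrix.of fun v e => if v ∈ (e : Sym2 V) then 1 else 0

theorem edgeIncMatrix_apply (G : SimpleGraph V) (v : V) (e : G.edgeSet) :
    edgeIncMatrix G v e = if v ∈ (e : Sym2 V) then 1 else 0 := rfl

variable (G : SimpleGraph V) [DecidableRel G.Adj]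

theorem edgeIncMatrix_eq_incMatrix (v : V) (e : G.edgeSet) :
    edgeIncMatrix G v e = G.incMatrix ℝ v e := by
  rw [edgeIncMatrix_apply, SimpleGraph.incMatrix_apply']
  simp [SimpleGraph.incidenceSet]

variable [Fintype V]

theorem sum_edgeIncMatrix_apply (e : G.edgeSet) : ∑ v, edgeIncMatrix G v e = 2 := by
  simp only [edgeIncMatrix_eq_incMatrix]
  exact G.sum_incMatrix_apply_of_mem_edgeSet e.2

/-- For a regular graph, `B Bᵀ = D + A = 2 D - L = 2 r - L`. -/
theorem edgeIncMatrix_mul_transpose {r : ℕ} (hr : G.IsRegularOfDegree r) :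
    edgeIncMatrix G * (edgeIncMatrix G)ᵀ = (2 * r : ℝ) • 1 - G.lapMatrix ℝ := by
  ext v w
  have h : (edgeIncMatrix G * (edgeIncMatrix G)ᵀ) v w =
      (G.incMatrix ℝ * (G.incMatrix ℝ)ᵀ) v w := by
    simp only [Matrix.mul_apply, Matrix.transpose_apply, edgeIncMatrix_eq_incMatrix]
    rw [← Finset.sum_subtype G.edgeFinset (fun _ => SimpleGraph.mem_edgeFinset)
      fun e => G.incMatrix ℝ v e * G.incMatrix ℝ w e]
    refine Finset.sum_subset (Finset.subset_univ _) fun e _ he => ?_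
    rw [G.incMatrix_of_notMem_incidenceSet fun h => he (SimpleGraph.mem_edgeFinset.2 h.1), zero_mul]
  rw [h, G.incMatrix_mul_transpose]
  rcases eq_or_ne v w with rfl | hvw
  · simp [lapMatrix_apply_self, hr.degree_eq v]
    ring
  · simp [lapMatrix_apply, hvw]

theorem sum_edgeIncMatrix_row {r : ℕ} (hr : G.IsRegularOfDegree r) (v : V) :
    ∑ e, edgeIncMatrix G v e = r := by
  have h := congrFun (congrFun (edgeIncMatrix_mul_transpose G hr) v) v
  have hsq : ∀ e, edgeIncMatrix G v e * edgeIncMatrix G v e = edgeIncMatrix G v e := fun e => by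
    rw [edgeIncMatrix_apply]
    split_ifs <;> norm_num
  simp only [Matrix.mul_apply, Matrix.transpose_apply, hsq] at h
  rw [h, Matrix.sub_apply, lapMatrix_apply_self, hr.degree_eq v]
  simp
  ring
end Incidence

/-! ### The Laplacian of the subdivision-vertex join -/

theorem sum_mul_col {l m n : Type*} [Fintype l] [Fintype m] (A : Matrix l m ℝ) (B : Matrix m n ℝ)
    {a : ℝ} (hA : ∀ j, ∑ i, A i j = a) (k : n) : ∑ i, (A * B) i k = a * ∑ j, B j k := by
  simp only [Matrix.mul_apply]
  rw [Finset.sum_comm]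
  simp only [← Finset.sum_mul, hA, ← Finset.mul_sum]

theorem trace_fromBlocks_eq_add {m n : Type*} [Fintype m] [Fintype n] (A : Matrix m m ℝ)
    (B : Matrix m n ℝ) (C : Matrix n m ℝ) (D : Matrix n n ℝ) :
    (fromBlocks A B C D).trace = A.trace + D.trace := by
  simp [Matrix.trace, Fintype.sum_sum_type]

section Join
variable {V₁ V₂ : Type*} [Fintype V₁] [DecidableEq V₁] [Fintype V₂]
  (G₁ : SimpleGraph V₁) [DecidableRel G₁.Adj] (G₂ : SimpleGraph V₂) [DecidableRel G₂.Adj]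

/-- The Laplacian in block form, over the old vertices of `G₁`, the edges of `G₁` and the vertices
of `G₂`, in this order. -/
theorem lapMatrix_subdivisionVertexJoin [DecidableEq V₂] {r : ℕ} (hr : G₁.IsRegularOfDegree r) :
    (subdivisionVertexJoin G₁ G₂).lapMatrix ℝ =
      fromBlocks
        (fromBlocks ((r + Fintype.card V₂ : ℝ) • 1) (-edgeIncMatrix G₁)
          (-(edgeIncMatrix G₁)ᵀ) ((2 : ℝ) • 1))
        (fromRows (Matrix.of fun _ _ => -1) 0)
        (fromCols (Matrix.of fun _ _ => -1) 0)
        (G₂.lapMatrix ℝ + (Fintype.card V₁ : ℝ) • 1) := by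
  have hrow : ∀ v, (∑ e : G₁.edgeSet, if v ∈ (e : Sym2 V₁) then (1 : ℝ) else 0) = r :=
    sum_edgeIncMatrix_row G₁ hr
  have hcol : ∀ e : G₁.edgeSet, (∑ v, if v ∈ (e : Sym2 V₁) then (1 : ℝ) else 0) = 2 :=
    sum_edgeIncMatrix_apply G₁
  have h11 : ∀ a b, (subdivisionVertexJoin G₁ G₂).Adj (.inl (.inl a)) (.inl (.inl b)) ↔ False :=
    fun _ _ => Iff.rfl
  have h12 : ∀ a e, (subdivisionVertexJoin G₁ G₂).Adj (.inl (.inl a)) (.inl (.inr e)) ↔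
    a ∈ (e : Sym2 V₁) := fun _ _ => Iff.rfl
  have h21 : ∀ a e, (subdivisionVertexJoin G₁ G₂).Adj (.inl (.inr e)) (.inl (.inl a)) ↔
    a ∈ (e : Sym2 V₁) := fun _ _ => Iff.rfl
  have h22 : ∀ a b, (subdivisionVertexJoin G₁ G₂).Adj (.inl (.inr a)) (.inl (.inr b)) ↔ False :=
    fun _ _ => Iff.rfl
  have h13 : ∀ a b, (subdivisionVertexJoin G₁ G₂).Adj (.inl (.inl a)) (.inr b) ↔ True :=
    fun _ _ => Iff.rfl
  have h31 : ∀ a b, (subdivisionVertexJoin G₁ G₂).Adj (.inr b) (.inl (.inl a)) ↔ True :=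
    fun _ _ => Iff.rfl
  have h23 : ∀ a b, (subdivisionVertexJoin G₁ G₂).Adj (.inl (.inr a)) (.inr b) ↔ False :=
    fun _ _ => Iff.rfl
  have h32 : ∀ a b, (subdivisionVertexJoin G₁ G₂).Adj (.inr b) (.inl (.inr a)) ↔ False :=
    fun _ _ => Iff.rfl
  have h33 : ∀ a b, (subdivisionVertexJoin G₁ G₂).Adj (.inr a) (.inr b) ↔ G₂.Adj a b :=
    fun _ _ => Iff.rfl
  ext ((v | e) | w) ((v' | e') | w') <;>
    simp only [lapMatrix_apply, Fintype.sum_sum_type, h11, h12, h21, h22, h13, h31, h23, h32, h33,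
      hrow, hcol, fromBlocks_apply₁₁, fromBlocks_apply₁₂, fromBlocks_apply₂₁, fromBlocks_apply₂₂,
      fromRows_apply_inl, fromRows_apply_inr, fromCols_apply_inl, fromCols_apply_inr,
      Matrix.add_apply, Matrix.neg_apply, Matrix.smul_apply, Matrix.one_apply,
      Matrix.transpose_apply, edgeIncMatrix_apply, Matrix.of_apply, Matrix.zero_apply,
      Sum.inl.injEq, Sum.inr.injEq, reduceCtorEq, if_true, if_false, Finset.sum_const_zero,
      Finset.sum_const, Finset.card_univ, nsmul_eq_mul, smul_eq_mul, mul_ite, mul_one, mul_zero,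
      add_zero, zero_add, sub_zero, zero_sub]
  split_ifs <;> ring

/-- A candidate for a generalized inverse of the Laplacian of the subdivision-vertex join, built
from a matrix `M` on `V₁` and a matrix `Q` on `V₂`. With `B` the incidence matrix of `G₁`, applying
it to a current `(b₁, b, b₂)` gives the potential `x₁ = M (b₁ + ½ B b)` on the old vertices,
the potential `½ (b + Bᵀ x₁)` on the edge vertices, as the current law there demands, and `Q b₂`
on `V₂`. -/
noncomputable def joinInverse (M : Matrix V₁ V₁ ℝ) (Q : Matrix V₂ V₂ ℝ) :
    Matrix ((V₁ ⊕ G₁.edgeSet) ⊕ V₂) ((V₁ ⊕ G₁.edgeSet) ⊕ V₂) ℝ :=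
  fromBlocks
    (fromBlocks M ((1 / 2 : ℝ) • (M * edgeIncMatrix G₁)) ((1 / 2 : ℝ) • ((edgeIncMatrix G₁)ᵀ * M))
      ((1 / 2 : ℝ) • 1 + (1 / 4 : ℝ) • ((edgeIncMatrix G₁)ᵀ * M * edgeIncMatrix G₁)))
    0 0 Q

variable {G₁ G₂} {r : ℕ} {M : Matrix V₁ V₁ ℝ} {Q : Matrix V₂ V₂ ℝ}

/-- `joinInverse` is a right inverse of the Laplacian up to a matrix with equal columns. The matrix
`2⁻¹ (L(G₁) + 2 |V₂|)` in the hypothesis on `M` is what remains of the Laplacian on `V₁` when the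
edge vertices are eliminated; the vanishing column sums of `M` decouple `V₁` from `V₂`. -/
theorem lapMatrix_mul_joinInverse [Nonempty V₁] [DecidableEq V₂] (hr : G₁.IsRegularOfDegree r)
    (hM : (G₁.lapMatrix ℝ + (2 * Fintype.card V₂ : ℝ) • 1) * M =
      (2 : ℝ) • (1 - Matrix.of fun _ _ => 1 / (Fintype.card V₁ : ℝ)))
    (hM0 : ∀ j, ∑ i, M i j = 0)
    (hQ : (G₂.lapMatrix ℝ + (Fintype.card V₁ : ℝ) • 1) * Q = 1) :
    (subdivisionVertexJoin G₁ G₂).lapMatrix ℝ * joinInverse G₁ M Q =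
      1 - Matrix.of fun u _ =>
        Sum.elim (Sum.elim (fun _ => 1 / (Fintype.card V₁ : ℝ)) fun _ => 0) (fun _ => 0) u := by
  have hn : (Fintype.card V₁ : ℝ) ≠ 0 := by exact_mod_cast Fintype.card_ne_zero
  have hQ0 : ∀ j, ∑ i, Q i j = 1 / (Fintype.card V₁ : ℝ) := fun j => by
    rw [eq_div_iff hn, mul_comm]
    exact sum_row_of_lapMatrix_add_smul_one_mul_eq_one hQ j
  set B := edgeIncMatrix G₁ with hB
  set J : Matrix V₁ V₁ ℝ := Matrix.of fun _ _ => 1 / (Fintype.card V₁ : ℝ) with hJ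
  have hBB := edgeIncMatrix_mul_transpose G₁ hr
  rw [← hB] at hBB
  -- The Schur complement of the edge block, applied to `M`.
  have hS : (r + Fintype.card V₂ : ℝ) • M - (1 / 2 : ℝ) • (B * (Bᵀ * M)) = 1 - J := by
    have : (r + Fintype.card V₂ : ℝ) • M - (1 / 2 : ℝ) • (B * (Bᵀ * M)) =
        (1 / 2 : ℝ) • ((G₁.lapMatrix ℝ + (2 * Fintype.card V₂ : ℝ) • 1) * M) := by
      rw [← Matrix.mul_assoc, hBB, Matrix.sub_mul, Matrix.add_mul, Matrix.smul_mul,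
        Matrix.smul_mul, Matrix.one_mul]
      module
    rw [this, hM, smul_smul]
    norm_num
  have hJB : ∀ v e, (J * B) v e = 2 * (1 / (Fintype.card V₁ : ℝ)) := fun v e => by
    rw [Matrix.mul_apply]
    simp only [hJ, Matrix.of_apply, ← Finset.mul_sum]
    rw [hB, sum_edgeIncMatrix_apply, mul_comm]
  rw [lapMatrix_subdivisionVertexJoin G₁ G₂ hr, joinInverse, ← hB, fromBlocks_multiply,
    fromBlocks_multiply, fromRows_mul, fromCols_mul_fromBlocks]
  have e11 : ((r + Fintype.card V₂ : ℝ) • (1 : Matrix V₁ V₁ ℝ)) * M +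
      (-B) * ((1 / 2 : ℝ) • (Bᵀ * M)) = 1 - J := by
    rw [← hS, Matrix.smul_mul, Matrix.one_mul, Matrix.neg_mul, Matrix.mul_smul, sub_eq_add_neg]
  have e12 : ((r + Fintype.card V₂ : ℝ) • (1 : Matrix V₁ V₁ ℝ)) * ((1 / 2 : ℝ) • (M * B)) +
      (-B) * ((1 / 2 : ℝ) • (1 : Matrix G₁.edgeSet G₁.edgeSet ℝ) + (1 / 4 : ℝ) • (Bᵀ * M * B)) =
      -((1 / 2 : ℝ) • (J * B)) := by
    have hJ' : J = 1 - ((r + Fintype.card V₂ : ℝ) • M - (1 / 2 : ℝ) • (B * (Bᵀ * M))) := by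
      rw [hS, sub_sub_cancel]
    rw [hJ']
    simp only [Matrix.sub_mul, Matrix.smul_mul, Matrix.one_mul, Matrix.neg_mul, Matrix.mul_smul,
      Matrix.mul_add, Matrix.mul_one, Matrix.mul_assoc]
    module
  have e21 : (-Bᵀ) * M +
      ((2 : ℝ) • (1 : Matrix G₁.edgeSet G₁.edgeSet ℝ)) * ((1 / 2 : ℝ) • (Bᵀ * M)) = 0 := by
    rw [Matrix.smul_mul, Matrix.one_mul, Matrix.neg_mul]
    module
  have e22 : (-Bᵀ) * ((1 / 2 : ℝ) • (M * B)) +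
      ((2 : ℝ) • (1 : Matrix G₁.edgeSet G₁.edgeSet ℝ)) *
        ((1 / 2 : ℝ) • (1 : Matrix G₁.edgeSet G₁.edgeSet ℝ) + (1 / 4 : ℝ) • (Bᵀ * M * B)) = 1 := by
    rw [Matrix.smul_mul, Matrix.one_mul, Matrix.neg_mul, Matrix.mul_smul, Matrix.mul_assoc]
    module
  rw [e11, e12, e21, e22, hQ]
  ext ((v | e) | w) ((v' | e') | w')
  · simp [Matrix.one_apply, hJ]
  · simp [hJB]
  · simp [Matrix.mul_apply, hQ0]
  · simp
  · simp [Matrix.one_apply]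
  · simp
  · simp [Matrix.mul_apply, hM0]
  · have h := sum_mul_col M B hM0 e'
    rw [zero_mul] at h
    simp [Matrix.mul_apply (M := Matrix.of _), h]
  · simp [Matrix.one_apply]

theorem trace_joinInverse [Nonempty V₁] (hr : G₁.IsRegularOfDegree r)
    (hM : (G₁.lapMatrix ℝ + (2 * Fintype.card V₂ : ℝ) • 1) * M =
      (2 : ℝ) • (1 - Matrix.of fun _ _ => 1 / (Fintype.card V₁ : ℝ))) :
    (joinInverse G₁ M Q).trace = (2 + r + Fintype.card V₂) / 2 * M.trace + Q.trace +
      (G₁.edgeFinset.card - Fintype.card V₁ + 1) / 2 := by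
  have hn : (Fintype.card V₁ : ℝ) ≠ 0 := by exact_mod_cast Fintype.card_ne_zero
  -- Cyclicity of the trace turns `Bᵀ M B` into `B Bᵀ M = (2 r - L) M`.
  have htr : ((edgeIncMatrix G₁)ᵀ * M * edgeIncMatrix G₁).trace =
      2 * r * M.trace - (G₁.lapMatrix ℝ * M).trace := by
    rw [Matrix.trace_mul_comm, ← Matrix.mul_assoc, edgeIncMatrix_mul_transpose G₁ hr,
      Matrix.sub_mul, Matrix.smul_mul, Matrix.one_mul, Matrix.trace_sub, Matrix.trace_smul,
      smul_eq_mul]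
  have hL : (G₁.lapMatrix ℝ * M).trace + 2 * Fintype.card V₂ * M.trace =
      2 * (Fintype.card V₁ - 1) := by
    have h := congrArg Matrix.trace hM
    have hJ : (Matrix.of fun _ _ : V₁ => 1 / (Fintype.card V₁ : ℝ)).trace = 1 := by
      simp [Matrix.trace, hn]
    rwa [Matrix.add_mul, Matrix.smul_mul, Matrix.one_mul, Matrix.trace_add, Matrix.trace_smul,
      smul_eq_mul, Matrix.trace_smul, Matrix.trace_sub, Matrix.trace_one, hJ, smul_eq_mul] at h
  rw [joinInverse, trace_fromBlocks_eq_add, trace_fromBlocks_eq_add, Matrix.trace_add,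
    Matrix.trace_smul, Matrix.trace_smul, htr, Matrix.trace_one, smul_eq_mul, smul_eq_mul,
    SimpleGraph.edgeFinset_card]
  linear_combination (-1 / 4 : ℝ) * hL

theorem sum_joinInverse (hr : G₁.IsRegularOfDegree r) (hM0 : ∀ j, ∑ i, M i j = 0) {q : ℝ}
    (hQ0 : ∀ j, ∑ i, Q i j = q) :
    ∑ u, ∑ v, joinInverse G₁ M Q u v = G₁.edgeFinset.card / 2 + Fintype.card V₂ * q := by
  have hMB := sum_mul_col M (edgeIncMatrix G₁) hM0
  have hBM := sum_mul_col (edgeIncMatrix G₁)ᵀ M (sum_edgeIncMatrix_row G₁ hr)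
  have hBMB := sum_mul_col ((edgeIncMatrix G₁)ᵀ * M) (edgeIncMatrix G₁) (a := 0)
    (fun j => by rw [hBM, hM0, mul_zero])
  -- Column sums: they are `0` on `V₁`, `1 / 2` on the edges and `q` on `V₂`.
  refine Finset.sum_comm.trans ?_
  simp only [Fintype.sum_sum_type, joinInverse, fromBlocks_apply₁₁, fromBlocks_apply₁₂,
    fromBlocks_apply₂₁, fromBlocks_apply₂₂, Matrix.add_apply, Matrix.smul_apply, smul_eq_mul,
    Finset.sum_add_distrib, ← Finset.mul_sum, hMB, hBM, hBMB, hM0, hQ0, Matrix.zero_apply,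
    Finset.sum_const_zero, Matrix.one_apply, SimpleGraph.edgeFinset_card]
  simp
  ring

end Join

end SubdivisionJoin

/-! ### The Kirchhoff index of the subdivision-vertex join -/

theorem mainTheorem8 {V₁ V₂ : Type*} [Fintype V₁] [DecidableEq V₁] [Nonempty V₁]
    [Fintype V₂] [DecidableEq V₂] [Nonempty V₂]
    (G₁ : SimpleGraph V₁) [DecidableRel G₁.Adj] (G₂ : SimpleGraph V₂) [DecidableRel G₂.Adj]
    (r₁ n₁ m₁ n₂ : ℕ) (hr₁ : G₁.IsRegularOfDegree r₁) (hn₁ : Fintype.card V₁ = n₁)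
    (hm₁ : G₁.edgeFinset.card = m₁) (hn₂ : Fintype.card V₂ = n₂) :
    SubdivisionJoin.kirchhoffIndex (SubdivisionJoin.subdivisionVertexJoin G₁ G₂) =
      ((m₁ : ℝ) + n₁ + n₂) *
        (((m₁ : ℝ) - n₁) / 2
          + (2 + (r₁ : ℝ) + n₁ + n₂) / (2 * (n₁ : ℝ) + 2 * n₂ + n₁ * r₁)
          + ∑ i ∈ Finset.Icc 2 n₂, 1 / ((n₁ : ℝ) + SubdivisionJoin.lapEigenvalue G₂ i)
          + ∑ i ∈ Finset.Icc 2 n₁,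
              (2 + (r₁ : ℝ) + n₂) / (2 * (n₂ : ℝ) + SubdivisionJoin.lapEigenvalue G₁ i)) := by
  have p₁ : (0 : ℝ) < Fintype.card V₁ := by exact_mod_cast Fintype.card_pos
  have p₂ : (0 : ℝ) < Fintype.card V₂ := by exact_mod_cast Fintype.card_pos
  have hm : (n₁ : ℝ) * r₁ = 2 * m₁ := by
    rw [← hn₁, ← hm₁]
    have h := G₁.sum_degrees_eq_twice_card_edges
    simp only [hr₁.degree_eq, Finset.sum_const, Finset.card_univ, smul_eq_mul] at h
    exact_mod_cast h
  obtain ⟨P, hP, htP⟩ :=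
    SubdivisionJoin.exists_inverse_lapMatrix_add_smul_one G₁ (mul_pos two_pos p₂)
  obtain ⟨Q, hQ, htQ⟩ := SubdivisionJoin.exists_inverse_lapMatrix_add_smul_one G₂ p₁
  have hP0 := SubdivisionJoin.sum_row_of_lapMatrix_add_smul_one_mul_eq_one hP
  have hQ0 := SubdivisionJoin.sum_row_of_lapMatrix_add_smul_one_mul_eq_one hQ
  set J : Matrix V₁ V₁ ℝ := Matrix.of fun _ _ => 1 / (Fintype.card V₁ : ℝ) with hJ
  have hLJ : G₁.lapMatrix ℝ * J = 0 := by
    ext v w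
    have h := congrFun (G₁.lapMatrix_mulVec_const_eq_zero (R := ℝ)) v
    simp only [Matrix.mulVec, dotProduct, mul_one, Pi.zero_apply] at h
    simp only [Matrix.mul_apply, hJ, Matrix.of_apply, ← Finset.sum_mul, h, zero_mul,
      Matrix.zero_apply]
  -- The multiple of the all-ones matrix is chosen to make the column sums of `M` vanish.
  set M : Matrix V₁ V₁ ℝ := (2 : ℝ) • P - (1 / (Fintype.card V₂ : ℝ)) • J with hMdef
  have hM : (G₁.lapMatrix ℝ + (2 * Fintype.card V₂ : ℝ) • 1) * M = (2 : ℝ) • (1 - J) := by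
    rw [hMdef, Matrix.mul_sub, Matrix.mul_smul, hP, Matrix.mul_smul, Matrix.add_mul, hLJ,
      Matrix.smul_mul, Matrix.one_mul, zero_add, smul_smul, smul_sub]
    congr 2
    field_simp
  have hM0 : ∀ j, ∑ i, M i j = 0 := fun j => by
    have h := hP0 j
    simp only [hMdef, hJ, Matrix.sub_apply, Matrix.smul_apply, Matrix.of_apply, smul_eq_mul,
      Finset.sum_sub_distrib, ← Finset.mul_sum, Finset.sum_const, Finset.card_univ, nsmul_eq_mul]
    field_simp
    linear_combination h
  have htM : M.trace = 2 * P.trace - 1 / Fintype.card V₂ := by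
    have : J.trace = 1 := by simp [hJ, Matrix.trace]
    rw [hMdef, Matrix.trace_sub, Matrix.trace_smul, Matrix.trace_smul, this]
    simp
  have hQ0' : ∀ j, ∑ i, Q i j = 1 / (Fintype.card V₁ : ℝ) := fun j => by
    rw [eq_div_iff p₁.ne', mul_comm, hQ0]
  rw [SubdivisionJoin.kirchhoffIndex_eq_of_lapMatrix_mul _ _ _
      (SubdivisionJoin.lapMatrix_mul_joinInverse hr₁ hM hM0 hQ),
    SubdivisionJoin.trace_joinInverse hr₁ hM, SubdivisionJoin.sum_joinInverse hr₁ hM0 hQ0',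
    htM, htP, htQ, Fintype.card_sum, Fintype.card_sum, ← Set.toFinset_card]
  have hE : G₁.edgeSet.toFinset.card = m₁ := hm₁
  simp only [hE, hm₁, hn₁, hn₂] at p₁ p₂ ⊢
  simp only [div_eq_mul_inv (2 + (r₁ : ℝ) + n₂), ← Finset.mul_sum, one_div]
  have hden : 2 * (n₁ : ℝ) + 2 * n₂ + n₁ * r₁ = 2 * (m₁ + n₁ + n₂) := by linear_combination hm
  rw [hden]
  have hN : (0 : ℝ) < m₁ + n₁ + n₂ := by positivity
  generalize ∑ i ∈ Finset.Icc 2 n₁, (2 * (n₂ : ℝ) + SubdivisionJoin.lapEigenvalue G₁ i)⁻¹ = S₁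
  generalize ∑ i ∈ Finset.Icc 2 n₂, ((n₁ : ℝ) + SubdivisionJoin.lapEigenvalue G₂ i)⁻¹ = S₂
  have hr : (r₁ : ℝ) = 2 * m₁ / n₁ := by field_simp; linarith
  push_cast
  rw [hr]
  field_simp
  ring
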